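/- For integers $k,m\ge 0$ and $r\ge 1$ let $$d_k(m,r)=\det\left(\binom{k+i+j}{m}\right)_{i,j=0}^{r-1}.$$ For integers $r\ge 1$ and $n,j\ge 0$ let $N(r,n,j)$ be the $r$-dimensional Narayana number, that is, the number of lattice paths $p_1p_2\cdots p_{rn}$ in $\mathbb{Z}^r$ from $(0,\dots,0)$ to $(n,\dots,n)$ whose steps are unit vectors $X_1=(1,0,\dots,0),\dots,X_r=(0,\dots,0,1)$, which stay in the region $0\le x_1\le x_2\le\cdots\le x_r$, and which have exactly $j$ ascents, where an ascent is an index $t$ such that $p_tp_{t+1}=X_aX_b$ with $a<b$. Then for all integers $r\ge 1$ and $m\ge r-1$ the following identity of formal power series over $\mathbb{Z}$ holds: $$(1-x)^{r(m-r+1)+1}\sum_{k\ge 0}d_k(m,r)\,x^k=(-1)^{\binom r2}\,x^{m-r+1}A_{m,r}(x),$$ where $$A_{m,r}(x)=\sum_{j=0}^{(r-1)(m-r)}N(r,m-r+1,j)\,x^j\quad\text{for } m\ge r,\qquad A_{r-1,r}(x)=N(r,0,0)=1.$$ -/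

import Mathlib

/-- The Hankel determinant `det (binom (k+i+j) m)`, `0 ≤ i, j ≤ r-1`. -/
def hankelDet (k m r : ℕ) : ℤ :=
  (Matrix.of fun i j : Fin r => (((k + i + j).choose m : ℕ) : ℤ)).det

/-- `P = p₁ p₂ ⋯` is a word in the steps `X₁, …, X_r` (the unit vectors of `ℤ^r`; `i : Fin r`
stands for `X_{i+1}`), read as a lattice path starting at the origin. After an initial segment
`Q` of `P` the path has reached the point with coordinates `Q.count i`. The path is required to
end at `(n, …, n)` and to stay in the region `0 ≤ x₁ ≤ x₂ ≤ ⋯ ≤ x_r`. -/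
def IsCatalanPath (r n : ℕ) (P : List (Fin r)) : Prop :=
  (∀ i, P.count i = n) ∧ ∀ Q, Q <+: P → ∀ i j, i ≤ j → Q.count i ≤ Q.count j

/-- The number of ascents: consecutive steps `p_t p_{t+1} = X_i X_j` with `i < j`. -/
def ascents {r : ℕ} (P : List (Fin r)) : ℕ :=
  (P.zip P.tail).countP fun p => p.1 < p.2

/-- There are only finitely many such paths, so that `Set.ncard` below really counts them. -/
theorem finite_isCatalanPath (r n : ℕ) : {P | IsCatalanPath r n P}.Finite := by
  refine (List.finite_length_eq (Fin r) (∑ _i : Fin r, n)).subset ?_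
  intro P hP
  have h := Multiset.sum_count_eq_card (s := Finset.univ) (m := (P : Multiset (Fin r)))
    (fun a _ => Finset.mem_univ a)
  simp only [Multiset.coe_count, Multiset.coe_card] at h
  rw [Set.mem_ofPred_eq, ← h]
  exact Finset.sum_congr rfl fun i _ => hP.1 i

/-- The `r`-dimensional Narayana number `N(r, n, j)`: the number of lattice paths from
`(0, …, 0)` to `(n, …, n)` in the region `0 ≤ x₁ ≤ ⋯ ≤ x_r` with exactly `j` ascents. -/
noncomputable def narayana (r n j : ℕ) : ℕ :=
  {P : List (Fin r) | IsCatalanPath r n P ∧ ascents P = j}.ncard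

/-- The polynomial `A_{m,r}(x) = ∑_{j=0}^{(r-1)(m-r)} N(r, m-r+1, j) x^j` for `m ≥ r ≥ 1`.
For `m = r - 1` the truncated upper limit is `0`, and the polynomial is `N(r, 0, 0) = 1`. -/
noncomputable def narayanaPoly (m r : ℕ) : Polynomial ℤ :=
  ∑ j ∈ Finset.range ((r - 1) * (m - r) + 1),
    Polynomial.C (narayana r (m + 1 - r) j : ℤ) * Polynomial.X ^ j

/-! Write n = m + 1 - r. Place bars in the r n + 1 gaps (both ends included) of a path to (n, …, n),
repetitions allowed, with at least one bar at every ascent. By number of bars, a path with a ascents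
contributes x^a / (1 - x)^(r n + 1). So it suffices that d_(n+K)(m, r) is (-1)^(r choose 2) times
the number of placements of K bars over all paths, and that d_k(m, r) = 0 for k < n.

Pascal-matrix operations and a row reversal turn the Hankel determinant into the Kreweras
determinant with entries binom(n + K, K + j - t), see `hankelDet_eq_coeff_barredSeries`. For every
monotone endpoint c, determinant and count are both refined by a threshold i and satisfy the same
`BallotRecurrence`, which determines them from their values at threshold r. Those values are the
ones at threshold 0 with one bar fewer, so induction on K applies (`coeff_succ_barredSeries`). -/

/-! ### Kreweras determinants -/

/-- Row entries of the Kreweras determinant counting multichains of order ideals. -/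
def krewerasRow {r : ℕ} (K t x : ℕ) : Fin r → ℤ := fun j =>
  if t ≤ K + j then ((x + K).choose (K + j - t) : ℤ) else 0

/-- The Kreweras matrix whose rows with index at least `i` have been advanced by one level. -/
def krewerasMatrix {r : ℕ} (K i : ℕ) (c : Fin r → ℕ) : Matrix (Fin r) (Fin r) ℤ :=
  Matrix.of fun t => if i ≤ t then krewerasRow (K + 1) t (c t) else krewerasRow K t (c t)

theorem krewerasMatrix_of_le {r K i : ℕ} {c : Fin r → ℕ} {t : Fin r} (h : i ≤ t) :
    krewerasMatrix K i c t = krewerasRow (K + 1) t (c t) :=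
  if_pos h

theorem krewerasMatrix_of_lt {r K i : ℕ} {c : Fin r → ℕ} {t : Fin r} (h : (t : ℕ) < i) :
    krewerasMatrix K i c t = krewerasRow K t (c t) :=
  if_neg (not_le.2 h)

/-- The difference of two consecutive levels of `krewerasRow`. -/
def krewerasDiff {r : ℕ} (K t x : ℕ) : Fin r → ℤ := fun j =>
  if t ≤ K + 1 + j then ((x + K).choose (K + 1 + j - t) : ℤ) else 0

theorem krewerasRow_succ {r : ℕ} (K t x : ℕ) :
    (krewerasRow (K + 1) t x : Fin r → ℤ) = krewerasRow K t x + krewerasDiff K t x := by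
  funext j
  simp only [krewerasRow, krewerasDiff, Pi.add_apply]
  by_cases h : t ≤ K + j
  · rw [if_pos (by omega), if_pos h, if_pos (by omega), ← add_assoc,
      show K + 1 + (j : ℕ) - t = (K + j - t) + 1 by omega, Nat.choose_succ_succ]
    push_cast; ring
  · rw [if_neg h]
    by_cases h' : t ≤ K + 1 + j
    · rw [if_pos h', if_pos h', show K + 1 + (j : ℕ) - t = 0 by omega]; simp
    · rw [if_neg h', if_neg h']; simp

theorem krewerasDiff_succ_right {r : ℕ} (K t x : ℕ) :
    (krewerasDiff K t (x + 1) : Fin r → ℤ) = krewerasRow (K + 1) t x := by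
  funext j
  simp only [krewerasRow, krewerasDiff]
  rw [show x + 1 + K = x + (K + 1) by omega]

theorem krewerasDiff_succ_left {r : ℕ} (K t x : ℕ) :
    (krewerasDiff K (t + 1) x : Fin r → ℤ) = krewerasRow K t x := by
  funext j
  simp only [krewerasRow, krewerasDiff]
  by_cases h : t ≤ K + j
  · rw [if_pos (by omega), if_pos h, show K + 1 + (j : ℕ) - (t + 1) = K + j - t by omega]
  · rw [if_neg (by omega), if_neg h]

theorem krewerasDiff_zero {r : ℕ} (K : ℕ) : (krewerasDiff K 0 0 : Fin r → ℤ) = 0 := by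
  funext j
  simp only [krewerasDiff]
  rw [if_pos (by omega), Nat.choose_eq_zero_of_lt (by omega)]; simp

theorem det_krewerasMatrix_eq_add {r : ℕ} (K : ℕ) (i : Fin r) (c : Fin r → ℕ) :
    (krewerasMatrix K i c).det = (krewerasMatrix K (i + 1) c).det +
      ((krewerasMatrix K i c).updateRow i (krewerasDiff K i (c i))).det := by
  have h1 : krewerasMatrix K i c = (krewerasMatrix K i c).updateRow i
      (krewerasRow K i (c i) + krewerasDiff K i (c i)) := by
    rw [← krewerasRow_succ]
    ext t j
    by_cases h : t = i
    · subst h; simp [krewerasMatrix]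
    · rw [Matrix.updateRow_ne h]
  have h2 : krewerasMatrix K (i + 1) c =
      (krewerasMatrix K i c).updateRow i (krewerasRow K i (c i)) := by
    ext t j
    by_cases h : t = i
    · subst h; simp [krewerasMatrix]
    · rw [Matrix.updateRow_ne h]
      have : (t : ℕ) ≠ i := fun h' => h (Fin.ext h')
      rcases lt_or_gt_of_ne this with h' | h'
      · rw [krewerasMatrix_of_lt h', krewerasMatrix_of_lt (by omega)]
      · rw [krewerasMatrix_of_le h'.le, krewerasMatrix_of_le (by omega)]
  rw [h2, ← Matrix.det_updateRow_add, ← h1]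

/-! ### The ballot recurrence -/

/-- A family indexed by a threshold `i` and a point `c` obeys the ballot recurrence if lowering
the threshold to `i` adds the contribution of the point `c - e_i`, provided that it is monotone. -/
def BallotRecurrence {r : ℕ} (F : ℕ → (Fin r → ℕ) → ℤ) : Prop :=
  ∀ (i : Fin r) (c : Fin r → ℕ), Monotone c →
    (∀ b : Fin r → ℕ, Monotone b → c = b + Pi.single i 1 → F i c = F (i + 1) c + F i b) ∧
    ((∀ b : Fin r → ℕ, Monotone b → c ≠ b + Pi.single i 1) → F i c = F (i + 1) c)

/-- Downward induction on the threshold; for a fixed threshold, induction on the coordinate sum,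
which is smaller at c - e_i. -/
theorem BallotRecurrence.eq {r : ℕ} {F G : ℕ → (Fin r → ℕ) → ℤ} (hF : BallotRecurrence F)
    (hG : BallotRecurrence G) (h : ∀ c, Monotone c → F r c = G r c) :
    ∀ i ≤ r, ∀ c, Monotone c → F i c = G i c := by
  intro i hi
  induction hi using Nat.decreasingInduction with
  | self => exact h
  | of_succ i hi ih =>
    have key : ∀ s : ℕ, ∀ c : Fin r → ℕ, Monotone c → ∑ t, c t = s → F i c = G i c := by
      intro s
      induction s using Nat.strong_induction_on with
      | _ s ihs =>
        intro c hc hs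
        by_cases hb : ∃ b : Fin r → ℕ, Monotone b ∧ c = b + Pi.single ⟨i, hi⟩ 1
        · obtain ⟨b, hb, e⟩ := hb
          have h1 := (hF ⟨i, hi⟩ c hc).1 b hb e
          have h2 := (hG ⟨i, hi⟩ c hc).1 b hb e
          have hlt : ∑ t, b t < s := by
            rw [← hs, e]
            simp [Finset.sum_add_distrib]
          simp only at h1 h2
          rw [h1, h2, ih c hc, ihs _ hlt b hb rfl]
        · push Not at hb
          have h1 := (hF ⟨i, hi⟩ c hc).2 hb
          have h2 := (hG ⟨i, hi⟩ c hc).2 hb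
          simp only at h1 h2
          rw [h1, h2, ih c hc]
    exact fun c hc => key _ c hc rfl

/-- A monotone point from which `e_i` cannot be subtracted within the monotone points. -/
theorem monotone_not_pred {r : ℕ} {i : Fin r} {c : Fin r → ℕ} (hc : Monotone c)
    (h : ∀ b : Fin r → ℕ, Monotone b → c ≠ b + Pi.single i 1) :
    ((i : ℕ) = 0 ∧ c i = 0) ∨ ∃ t : Fin r, (t : ℕ) + 1 = i ∧ c t = c i := by
  by_contra hcon
  push Not at hcon
  obtain ⟨h0, h1⟩ := hcon
  have hlt : ∀ t : Fin r, t < i → c t < c i := by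
    intro t ht
    have ht' : (t : ℕ) < i := ht
    let s : Fin r := ⟨i - 1, by omega⟩
    have hs : (s : ℕ) = i - 1 := rfl
    have h2 := h1 s (by omega)
    have h3 : c s ≤ c i := hc (Fin.le_def.2 (by omega))
    have h4 : c t ≤ c s := hc (Fin.le_def.2 (by omega))
    omega
  have hpos : 0 < c i := by
    by_cases hi : (i : ℕ) = 0
    · exact Nat.pos_of_ne_zero (h0 hi)
    · exact lt_of_le_of_lt (Nat.zero_le _)
        (hlt ⟨0, by have := i.2; omega⟩ (Fin.lt_def.2 (by simp; omega)))
  refine h (Function.update c i (c i - 1)) ?_ ?_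
  · intro s t hst
    by_cases hs : s = i
    · subst hs
      by_cases ht : t = s
      · subst ht; rfl
      · have := hc hst
        simp [Function.update_of_ne ht]; omega
    · by_cases ht : t = i
      · subst ht
        have := hlt s (lt_of_le_of_ne hst hs)
        simp [Function.update_of_ne hs]; omega
      · simpa [Function.update_of_ne hs, Function.update_of_ne ht] using hc hst
  · funext t
    by_cases ht : t = i
    · subst ht; simp; omega
    · simp [ht]

/-- Splitting row i by linearity leaves a determinant with the difference row. If c - e_i is
monotone, this is its row i at level K + 1; otherwise it is zero (i = 0, c_i = 0) or repeats row i -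
1 (c_(i-1) = c_i). -/
theorem ballotRecurrence_det (r K : ℕ) :
    BallotRecurrence fun i (c : Fin r → ℕ) => (krewerasMatrix K i c).det := by
  intro i c hc
  refine ⟨fun b _ e => ?_, fun h => ?_⟩
  · simp only
    rw [det_krewerasMatrix_eq_add]
    congr 2
    ext t j
    by_cases ht : t = i
    · subst ht
      simp [e, krewerasDiff_succ_right, krewerasMatrix]
    · rw [Matrix.updateRow_ne ht]
      simp [krewerasMatrix, e, ht]
  · simp only
    rw [det_krewerasMatrix_eq_add, add_eq_left]
    rcases monotone_not_pred hc h with ⟨hi, h0⟩ | ⟨t, ht, e⟩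
    · apply Matrix.det_eq_zero_of_row_eq_zero i
      intro j
      rw [Matrix.updateRow_self, h0, hi, krewerasDiff_zero]; rfl
    · have hne : t ≠ i := by rintro rfl; omega
      apply Matrix.det_zero_of_row_eq hne
      rw [Matrix.updateRow_self, Matrix.updateRow_ne hne, ← ht, krewerasDiff_succ_left, ← e,
        krewerasMatrix_of_lt (by omega)]

/-- This is the count without bars: the word is weakly decreasing, hence unique, and its letters are
at least i. -/
theorem ballotRecurrence_indicator (r : ℕ) :
    BallotRecurrence fun i (c : Fin r → ℕ) =>
      if ∀ t : Fin r, (t : ℕ) < i → c t = 0 then 1 else 0 := by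
  intro i c hc
  refine ⟨fun b hb e => ?_, fun h => ?_⟩
  · have h1 : ¬ ∀ t : Fin r, (t : ℕ) < i + 1 → c t = 0 := by
      intro h
      have := h i (by omega)
      simp [e] at this
    simp only [if_neg h1, zero_add]
    congr 1
    apply propext
    refine forall₂_congr fun t ht => ?_
    have : t ≠ i := by rintro rfl; omega
    simp [e, this]
  · simp only
    congr 1
    apply propext
    refine ⟨fun h0 t ht => ?_, fun h0 t ht => h0 t (by omega)⟩
    rcases Nat.lt_succ_iff_lt_or_eq.1 ht with ht | ht
    · exact h0 t ht
    · obtain rfl : t = i := Fin.ext ht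
      rcases monotone_not_pred hc h with ⟨_, h2⟩ | ⟨s, hs, e⟩
      · exact h2
      · rw [← e]; exact h0 s (by omega)

theorem krewerasMatrix_top {r : ℕ} (K : ℕ) (c : Fin r → ℕ) :
    krewerasMatrix (K + 1) r c = krewerasMatrix K 0 c := by
  ext t j
  rw [krewerasMatrix_of_lt t.2, krewerasMatrix_of_le (Nat.zero_le _)]

theorem det_krewerasMatrix_zero {r : ℕ} (c : Fin r → ℕ) : (krewerasMatrix 0 r c).det = 1 := by
  rw [Matrix.det_of_isUpperTriangular]
  · apply Finset.prod_eq_one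
    intro t _
    rw [krewerasMatrix_of_lt t.2]
    simp [krewerasRow]
  · intro t j h
    have h' : (j : ℕ) < t := h
    rw [krewerasMatrix_of_lt t.2]
    exact if_neg (by omega)

/-! ### Reduction of the Hankel determinant -/

theorem sign_revPerm (r : ℕ) :
    Equiv.Perm.sign (Fin.revPerm : Equiv.Perm (Fin r)) = (-1) ^ r.choose 2 := by
  rw [Equiv.Perm.sign_eq_prod_prod_Iio]
  have : ∀ j : Fin r, ∏ i ∈ Finset.Iio j,
      (if (Fin.revPerm i : Fin r) < Fin.revPerm j then (1 : ℤˣ) else -1) = (-1) ^ (j : ℕ) := by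
    intro j
    rw [Finset.prod_congr rfl (g := fun _ => (-1 : ℤˣ))]
    · simp
    · intro i hi
      have hi := Finset.mem_Iio.1 hi
      rw [if_neg]
      simpa using hi.le
  rw [Finset.prod_congr rfl fun j _ => this j, Finset.prod_pow_eq_pow_sum,
    Fin.sum_univ_eq_sum_range (fun i => i), Finset.sum_range_id, Nat.choose_two_right]

open Polynomial in
-- Expanding (1 + X)^i and (1 + X)^j in (1 + X)^(k+i+j) factors the Hankel matrix as T M Tᵀ, with T
-- the unitriangular Pascal matrix.
theorem hankelDet_eq_det_coeff (k m r : ℕ) :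
    hankelDet k m r =
      (Matrix.of fun i j : Fin r => ((X ^ (i + j : ℕ) * (1 + X) ^ k : ℤ[X])).coeff m).det := by
  let T : Matrix (Fin r) (Fin r) ℤ := Matrix.of fun i l => ((i : ℕ).choose l : ℤ)
  have hT : T.det = 1 := by
    rw [Matrix.det_of_isLowerTriangular]
    · simp [T]
    · intro i j h
      have h' : (i : ℕ) < j := h
      simp [T, Nat.choose_eq_zero_of_lt h']
  have hpow : ∀ i : Fin r, ((1 + X : ℤ[X]) ^ (i : ℕ)) = ∑ l : Fin r, C (T i l) * X ^ (l : ℕ) := by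
    intro i
    change _ = ∑ l : Fin r, C (((i : ℕ).choose l : ℤ)) * (X : ℤ[X]) ^ (l : ℕ)
    rw [Fin.sum_univ_eq_sum_range (fun l => C (((i : ℕ).choose l : ℤ)) * (X : ℤ[X]) ^ l) r,
      add_comm, add_pow]
    rw [← Finset.sum_subset (Finset.range_subset_range.2 (Nat.succ_le_of_lt i.2))]
    · refine Finset.sum_congr rfl fun l _ => ?_
      simp; ring
    · intro l _ hl
      rw [Nat.choose_eq_zero_of_lt (by simpa using hl)]; simp
  have key : (Matrix.of fun i j : Fin r => (((k + i + j).choose m : ℕ) : ℤ)) =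
      T * (Matrix.of fun i j : Fin r => ((X ^ (i + j : ℕ) * (1 + X) ^ k : ℤ[X])).coeff m)
        * T.transpose := by
    ext i j
    have : ((1 + X : ℤ[X]) ^ (k + i + j : ℕ)) =
        ∑ l' : Fin r, ∑ l : Fin r, C (T i l * T j l') * (X ^ (l + l' : ℕ) * (1 + X) ^ k) := by
      rw [pow_add, pow_add, hpow i, hpow j, Finset.mul_sum]
      refine Finset.sum_congr rfl fun l' _ => ?_
      rw [Finset.mul_sum, Finset.sum_mul]
      refine Finset.sum_congr rfl fun l _ => ?_
      rw [C_mul, pow_add]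
      ring
    rw [Matrix.mul_apply]
    simp only [Matrix.mul_apply, Matrix.of_apply, Matrix.transpose_apply]
    rw [← coeff_one_add_X_pow, this]
    simp only [finsetSum_coeff, coeff_C_mul, Finset.sum_mul]
    refine Finset.sum_congr rfl fun l' _ => Finset.sum_congr rfl fun l _ => by ring
  rw [hankelDet, key, Matrix.det_mul, Matrix.det_mul, Matrix.det_transpose, hT, one_mul, mul_one]

/-! ### Ascents and ballot paths -/

theorem ascents_cons_cons {r : ℕ} (a b : Fin r) (P : List (Fin r)) :
    ascents (a :: b :: P) = ascents (b :: P) + if a < b then 1 else 0 := by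
  simp [ascents, List.countP_cons]

theorem ascents_concat {r : ℕ} (P : List (Fin r)) (l : Fin r) :
    ascents (P ++ [l]) = ascents P + if ∀ a ∈ P.getLast?, l ≤ a then 0 else 1 := by
  induction P with
  | nil => simp [ascents]
  | cons a P ih =>
    cases P with
    | nil =>
      by_cases h : l ≤ a
      · simp [ascents, h]
      · simp [ascents, h, not_le.1 h]
    | cons b P =>
      rw [List.cons_append, List.cons_append, ascents_cons_cons, ascents_cons_cons,
        ← List.cons_append, ih, List.getLast?_cons_cons]
      ring

/-- Lattice paths from the origin to `c` inside the region `x₁ ≤ ⋯ ≤ x_r`. -/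
def IsBallotPath {r : ℕ} (c : Fin r → ℕ) (P : List (Fin r)) : Prop :=
  (∀ i, P.count i = c i) ∧ ∀ Q, Q <+: P → ∀ i j, i ≤ j → Q.count i ≤ Q.count j

theorem IsBallotPath.monotone {r : ℕ} {c : Fin r → ℕ} {P : List (Fin r)} (h : IsBallotPath c P) :
    Monotone c := by
  intro i j hij
  rw [← h.1, ← h.1]
  exact h.2 P List.prefix_rfl i j hij

theorem IsBallotPath.length {r : ℕ} {c : Fin r → ℕ} {P : List (Fin r)} (h : IsBallotPath c P) :
    P.length = ∑ i, c i := by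
  have h' := Multiset.sum_count_eq_card (s := Finset.univ) (m := (P : Multiset (Fin r)))
    (fun a _ => Finset.mem_univ a)
  simp only [Multiset.coe_count, Multiset.coe_card] at h'
  rw [← h']
  exact Finset.sum_congr rfl fun i _ => h.1 i

theorem finite_isBallotPath {r : ℕ} (c : Fin r → ℕ) : {P | IsBallotPath c P}.Finite :=
  (List.finite_length_eq (Fin r) (∑ i, c i)).subset fun _ hP => hP.length

/-- The finite set of lattice paths from the origin to `c` inside the region `x₁ ≤ ⋯ ≤ x_r`. -/
noncomputable def ballotPaths {r : ℕ} (c : Fin r → ℕ) : Finset (List (Fin r)) :=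
  (finite_isBallotPath c).toFinset

theorem mem_ballotPaths {r : ℕ} {c : Fin r → ℕ} {P : List (Fin r)} :
    P ∈ ballotPaths c ↔ IsBallotPath c P := by
  simp [ballotPaths]

theorem isBallotPath_concat {r : ℕ} {c b : Fin r → ℕ} {i : Fin r} (hc : Monotone c)
    (e : c = b + Pi.single i 1) (P : List (Fin r)) :
    IsBallotPath c (P ++ [i]) ↔ IsBallotPath b P := by
  have hcount : (∀ j, (P ++ [i]).count j = c j) ↔ ∀ j, P.count j = b j := by
    refine forall_congr' fun j => ?_
    by_cases h : j = i
    · subst h; simp [e]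
    · simp [e, h, Ne.symm h]
  constructor
  · rintro ⟨h1, h2⟩
    exact ⟨hcount.1 h1, fun Q hQ => h2 Q (hQ.trans (List.prefix_append _ _))⟩
  · rintro ⟨h1, h2⟩
    refine ⟨hcount.2 h1, fun Q hQ s t hst => ?_⟩
    rcases List.prefix_concat_iff.1 hQ with rfl | hQ
    · rw [hcount.2 h1, hcount.2 h1]; exact hc hst
    · exact h2 Q hQ s t hst

/-! ### Barred paths -/

open PowerSeries

/-- The generating function by number of bars of the placements of bars in the gaps and at both
ends of the word `P` such that every ascent is separated by at least one bar. -/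
noncomputable def barredWeight {r : ℕ} (P : List (Fin r)) : ℤ⟦X⟧ :=
  X ^ ascents P * mk 1 ^ (P.length + 1)

open Classical in
/-- As `barredWeight`, where the letters after the last bar are required to be at least `i`. -/
noncomputable def barredWeightFrom {r : ℕ} (i : ℕ) (P : List (Fin r)) : ℤ⟦X⟧ :=
  X * barredWeight P + if ∀ a ∈ P.getLast?, i ≤ (a : ℕ) then (1 - X) * barredWeight P else 0

theorem barredWeightFrom_zero {r : ℕ} (P : List (Fin r)) :
    barredWeightFrom 0 P = barredWeight P := by
  simp only [barredWeightFrom, Nat.zero_le, implies_true, if_true]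
  ring

/-- The factor 1 - X selects the placements with no bar after l. Deleting l leaves a placement on P,
with a bar forced at the end exactly when l would create an ascent. -/
theorem one_sub_mul_barredWeight_concat {r : ℕ} (P : List (Fin r)) (l : Fin r) :
    (1 - X) * barredWeight (P ++ [l]) = barredWeightFrom l P := by
  have h : (1 - X) * barredWeight (P ++ [l]) = X ^ ascents (P ++ [l]) * mk 1 ^ (P.length + 1) := by
    rw [barredWeight, List.length_append, List.length_singleton, pow_succ _ (P.length + 1)]
    linear_combination (X ^ ascents (P ++ [l]) * mk 1 ^ (P.length + 1)) *
      (mk_one_mul_one_sub_eq_one ℤ)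
  rw [h, ascents_concat, barredWeightFrom, barredWeight]
  by_cases hl : ∀ a ∈ P.getLast?, l ≤ a
  · rw [if_pos hl, if_pos (by simpa using hl)]; ring
  · rw [if_neg hl, if_neg (by simpa using hl)]; ring

theorem barredWeightFrom_sub {r : ℕ} (i : Fin r) (P : List (Fin r)) :
    barredWeightFrom i P = barredWeightFrom (i + 1) P +
      if P.getLast? = some i then (1 - X) * barredWeight P else 0 := by
  unfold barredWeightFrom
  cases h : P.getLast? with
  | none => simp
  | some a =>
    simp only [Option.mem_def, Option.some.injEq, forall_eq']
    by_cases ha : a = i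
    · subst ha; simp
    · have : (a : ℕ) ≠ i := fun h => ha (Fin.ext h)
      by_cases h1 : (i : ℕ) ≤ a
      · rw [if_pos h1, if_pos (by omega), if_neg ha, add_zero]
      · rw [if_neg h1, if_neg (by omega), if_neg ha, add_zero, add_zero]

/-- No letter may follow the last bar, so a bar ends the word, unless the word is empty and has no
bars. -/
theorem barredWeightFrom_top {r : ℕ} (P : List (Fin r)) :
    barredWeightFrom r P = X * barredWeight P + if P = [] then 1 else 0 := by
  unfold barredWeightFrom
  rcases List.eq_nil_or_concat P with rfl | ⟨Q, l, rfl⟩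
  · have := mk_one_mul_one_sub_eq_one ℤ
    simp [barredWeight, ascents]
    rw [mul_comm, this]
  · have := l.2
    simp

/-- The generating function of the barred lattice paths to `c` whose letters after the last bar
are at least `i`. -/
noncomputable def barredSeries {r : ℕ} (i : ℕ) (c : Fin r → ℕ) : ℤ⟦X⟧ :=
  ∑ P ∈ ballotPaths c, barredWeightFrom i P

theorem barredSeries_eq_add {r : ℕ} (i : Fin r) (c : Fin r → ℕ) :
    barredSeries i c = barredSeries (i + 1) c +
      ∑ P ∈ ballotPaths c with P.getLast? = some i, (1 - X) * barredWeight P := by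
  rw [barredSeries, barredSeries, Finset.sum_filter, ← Finset.sum_add_distrib]
  exact Finset.sum_congr rfl fun P _ => barredWeightFrom_sub i P

/-- The additional placements end in a letter i with no bar after it; deleting that letter maps them
bijectively to those for b at threshold i. -/
theorem barredSeries_of_pred {r : ℕ} {i : Fin r} {c b : Fin r → ℕ} (hc : Monotone c)
    (e : c = b + Pi.single i 1) :
    barredSeries i c = barredSeries (i + 1) c + barredSeries i b := by
  rw [barredSeries_eq_add]
  congr 1
  have : (ballotPaths c).filter (fun P => P.getLast? = some i) =
      (ballotPaths b).image fun P => P ++ [i] := by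
    ext P
    simp only [Finset.mem_filter, Finset.mem_image, mem_ballotPaths]
    constructor
    · rintro ⟨hP, hl⟩
      obtain ⟨Q, rfl⟩ := List.getLast?_eq_some_iff.1 hl
      exact ⟨Q, (isBallotPath_concat hc e Q).1 hP, rfl⟩
    · rintro ⟨Q, hQ, rfl⟩
      exact ⟨(isBallotPath_concat hc e Q).2 hQ, by simp⟩
  rw [this, Finset.sum_image fun _ _ _ _ h => List.append_cancel_right h]
  exact Finset.sum_congr rfl fun P _ => one_sub_mul_barredWeight_concat P i

theorem barredSeries_of_not_pred {r : ℕ} {i : Fin r} {c : Fin r → ℕ} (hc : Monotone c)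
    (h : ∀ b : Fin r → ℕ, Monotone b → c ≠ b + Pi.single i 1) :
    barredSeries i c = barredSeries (i + 1) c := by
  rw [barredSeries_eq_add, add_eq_left]
  apply Finset.sum_eq_zero
  intro P hP
  exfalso
  simp only [Finset.mem_filter, mem_ballotPaths] at hP
  obtain ⟨hP, hl⟩ := hP
  obtain ⟨Q, rfl⟩ := List.getLast?_eq_some_iff.1 hl
  have e : c = (fun j => Q.count j) + Pi.single i 1 := by
    funext j
    rw [← hP.1 j]
    by_cases h : j = i
    · subst h; simp
    · simp [h, Ne.symm h]
  exact h _ ((isBallotPath_concat hc e Q).1 hP).monotone e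

theorem barredSeries_top {r : ℕ} {c : Fin r → ℕ} :
    barredSeries r c = X * barredSeries 0 c + if ∀ t, c t = 0 then 1 else 0 := by
  simp only [barredSeries, barredWeightFrom_top, barredWeightFrom_zero, Finset.sum_add_distrib,
    Finset.mul_sum, Finset.sum_ite_eq']
  congr 1
  have : [] ∈ ballotPaths c ↔ ∀ t, c t = 0 := by
    simp [mem_ballotPaths, IsBallotPath, eq_comm (a := 0)]
  exact if_congr this rfl rfl

theorem ballotRecurrence_coeff (r K : ℕ) :
    BallotRecurrence fun i (c : Fin r → ℕ) => coeff K (barredSeries i c) := by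
  intro i c hc
  refine ⟨fun b _ e => ?_, fun h => ?_⟩
  · simp only [barredSeries_of_pred hc e, map_add]
  · simp only [barredSeries_of_not_pred hc h]

theorem coeff_zero_barredSeries {r : ℕ} {c : Fin r → ℕ} (hc : Monotone c) :
    coeff 0 (barredSeries 0 c) = 1 := by
  have := (ballotRecurrence_coeff r 0).eq (ballotRecurrence_indicator r) (fun c _ => by
    simp only [barredSeries_top]
    simp) 0 (Nat.zero_le _) c hc
  simpa using this

theorem coeff_succ_barredSeries {r : ℕ} (K : ℕ) :
    ∀ i ≤ r, ∀ c : Fin r → ℕ, Monotone c →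
      coeff (K + 1) (barredSeries i c) = (krewerasMatrix K i c).det := by
  have top (K : ℕ) (c : Fin r → ℕ) :
      coeff (K + 1) (barredSeries r c) = coeff K (barredSeries 0 c) := by
    rw [barredSeries_top, map_add, coeff_succ_X_mul, add_eq_left]
    split_ifs
    · simp [coeff_one]
    · simp
  induction K with
  | zero =>
    refine (ballotRecurrence_coeff r 1).eq (ballotRecurrence_det r 0) fun c hc => ?_
    rw [det_krewerasMatrix_zero, ← coeff_zero_barredSeries hc]
    exact top 0 c
  | succ K ih =>
    refine (ballotRecurrence_coeff r (K + 2)).eq (ballotRecurrence_det r (K + 1)) fun c hc => ?_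
    rw [krewerasMatrix_top, ← ih 0 (Nat.zero_le _) c hc]
    exact top (K + 1) c

/-- The number of multichains of `K` order ideals, as a Kreweras determinant. -/
theorem coeff_barredSeries {r : ℕ} (K : ℕ) {c : Fin r → ℕ} (hc : Monotone c) :
    coeff K (barredSeries 0 c) = (krewerasMatrix K r c).det := by
  cases K with
  | zero => rw [det_krewerasMatrix_zero, coeff_zero_barredSeries hc]
  | succ K => rw [krewerasMatrix_top, coeff_succ_barredSeries K 0 (Nat.zero_le _) c hc]

/-! ### Narayana polynomials and the final identity -/

theorem hankelDet_eq_coeff_barredSeries (r n K m : ℕ) (hm : m + 1 = n + r) :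
    hankelDet (n + K) m r =
      (-1) ^ r.choose 2 * coeff K (barredSeries 0 (fun _ : Fin r => n)) := by
  rw [coeff_barredSeries K monotone_const, hankelDet_eq_det_coeff]
  -- With i = r - 1 - t and m = n + r - 1, the lower index m - i - j is n + t - j, whose complement
  -- in n + K is K + j - t.
  have h : krewerasMatrix K r (fun _ : Fin r => n) =
      (Matrix.of fun i j : Fin r => ((Polynomial.X ^ (i + j : ℕ) *
        (1 + Polynomial.X) ^ (n + K) : Polynomial ℤ)).coeff m).submatrix Fin.revPerm id := by
    ext t j
    rw [krewerasMatrix_of_lt t.2]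
    have ht := t.2
    simp only [krewerasRow, Matrix.submatrix_apply, Matrix.of_apply, Polynomial.coeff_X_pow_mul',
      Polynomial.coeff_one_add_X_pow, Fin.revPerm_apply, Fin.val_rev, id]
    by_cases h1 : (j : ℕ) ≤ n + t
    · by_cases h2 : (t : ℕ) ≤ K + j
      · rw [if_pos h2, if_pos (by omega), ← Nat.choose_symm (by omega)]
        congr 2
        omega
      · rw [if_neg h2, if_pos (by omega), Nat.choose_eq_zero_of_lt (by omega)]; simp
    · rw [if_neg (show ¬ r - (t + 1) + (j : ℕ) ≤ m by omega)]
      split_ifs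
      · rw [Nat.choose_eq_zero_of_lt (by omega)]; simp
      · rfl
  rw [h, Matrix.det_permute, sign_revPerm, ← mul_assoc]
  push_cast
  rw [← mul_pow]
  simp

theorem hankelDet_eq_zero {r k m : ℕ} (hr : 1 ≤ r) (hk : k + r ≤ m) : hankelDet k m r = 0 := by
  apply Matrix.det_eq_zero_of_row_eq_zero ⟨0, hr⟩
  intro j
  have := j.2
  simp only [Matrix.of_apply]
  rw [Nat.choose_eq_zero_of_lt (by omega)]; simp

/-- If an ascent ends in l, a smaller letter has already occurred, so by the ballot condition l has
too. Thus the first occurrence of a letter never ends an ascent, and neither does the smallest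
letter. -/
theorem ascents_le {r : ℕ} (P : List (Fin r))
    (h : ∀ Q, Q <+: P → ∀ i j, i ≤ j → Q.count i ≤ Q.count j) :
    ascents P ≤ ∑ b : Fin r, if (b : ℕ) = 0 then 0 else P.count b - 1 := by
  induction P using List.reverseRecOn with
  | nil => simp [ascents]
  | append_singleton P l ih =>
    have ih := ih fun Q hQ => h Q (hQ.trans (List.prefix_append _ _))
    have hle : ∀ b : Fin r, (if (b : ℕ) = 0 then 0 else P.count b - 1) ≤
        if (b : ℕ) = 0 then 0 else (P ++ [l]).count b - 1 := by
      intro b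
      split_ifs
      · rfl
      · rw [List.count_append]; omega
    rw [ascents_concat]
    split_ifs with hl
    · exact ih.trans (Finset.sum_le_sum fun b _ => hle b)
    · push Not at hl
      obtain ⟨a, ha, hal⟩ := hl
      refine Nat.succ_le_of_lt (lt_of_le_of_lt ih ?_)
      refine Finset.sum_lt_sum (fun b _ => hle b) ⟨l, Finset.mem_univ l, ?_⟩
      have hal' : (a : ℕ) < l := hal
      have h1 : 0 < P.count a := List.count_pos_iff.2 (List.mem_of_getLast? ha)
      have h2 := h P (List.prefix_append _ _) a l hal.le
      rw [if_neg (by omega), if_neg (by omega), List.count_append, List.count_singleton_self]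
      omega

/-- By `ascents_le` a path has at most (r - 1)(m - r) ascents, so the range of summation omits no
path. -/
theorem sum_ascents_eq_narayanaPoly (m r : ℕ) (hr : 1 ≤ r) (hm : r ≤ m + 1) :
    ∑ P ∈ ballotPaths (fun _ : Fin r => m + 1 - r), (X : ℤ⟦X⟧) ^ ascents P = narayanaPoly m r := by
  have hmaps : ∀ P ∈ ballotPaths (fun _ : Fin r => m + 1 - r),
      ascents P ∈ Finset.range ((r - 1) * (m - r) + 1) := by
    intro P hP
    rw [mem_ballotPaths] at hP
    have h := ascents_le P hP.2
    obtain ⟨s, rfl⟩ : ∃ s, r = s + 1 := ⟨r - 1, by omega⟩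
    simp only [hP.1] at h
    rw [Fin.sum_univ_succ] at h
    simp at h
    rw [Finset.mem_range, Nat.lt_succ_iff, Nat.add_sub_cancel]
    exact h.trans (le_of_eq (by congr 1))
  rw [← Finset.sum_fiberwise_of_maps_to hmaps, narayanaPoly]
  rw [← Polynomial.coeToPowerSeries.ringHom_apply, map_sum]
  refine Finset.sum_congr rfl fun j _ => ?_
  rw [Finset.sum_congr rfl (g := fun _ => (X : ℤ⟦X⟧) ^ j)
    fun P hP => by rw [(Finset.mem_filter.1 hP).2]]
  rw [Finset.sum_const, narayana]
  have : {P : List (Fin r) | IsCatalanPath r (m + 1 - r) P ∧ ascents P = j} =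
      ((ballotPaths (fun _ : Fin r => m + 1 - r)).filter fun P => ascents P = j : Finset _) := by
    ext P
    simp [mem_ballotPaths, IsBallotPath, IsCatalanPath]
  rw [this, Set.ncard_coe_finset]
  simp
  exact (map_natCast Polynomial.coeToPowerSeries.ringHom _).symm

theorem theorem2 (m r : ℕ) (hr : 1 ≤ r) (hm : r ≤ m + 1) :
    (1 - PowerSeries.X) ^ (r * (m + 1 - r) + 1) *
        PowerSeries.mk (fun k => hankelDet k m r) =
      (-1) ^ (r.choose 2) * PowerSeries.X ^ (m + 1 - r) *
        (narayanaPoly m r : PowerSeries ℤ) := by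
  rw [← sum_ascents_eq_narayanaPoly m r hr hm]
  set n := m + 1 - r with hn
  have hmk : PowerSeries.mk (fun k => hankelDet k m r) =
      (-1) ^ r.choose 2 * X ^ n * barredSeries 0 (fun _ : Fin r => n) := by
    ext k
    have hC : ((-1) ^ r.choose 2 : ℤ⟦X⟧) = C ((-1) ^ r.choose 2 : ℤ) := by simp
    rw [coeff_mk, hC, mul_assoc, coeff_C_mul, coeff_X_pow_mul']
    split_ifs with h
    · obtain ⟨K, rfl⟩ := Nat.exists_eq_add_of_le h
      rw [hankelDet_eq_coeff_barredSeries r n K m (by omega), Nat.add_sub_cancel_left]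
    · rw [hankelDet_eq_zero hr (by omega), mul_zero]
  have hseries : barredSeries 0 (fun _ : Fin r => n) =
      (∑ P ∈ ballotPaths (fun _ : Fin r => n), (X : ℤ⟦X⟧) ^ ascents P) *
        mk 1 ^ (r * n + 1) := by
    rw [barredSeries, Finset.sum_mul]
    refine Finset.sum_congr rfl fun P hP => ?_
    rw [barredWeightFrom_zero, barredWeight, (mem_ballotPaths.1 hP).length]
    simp
  have hinv : (mk 1 : ℤ⟦X⟧) ^ (r * n + 1) * (1 - X) ^ (r * n + 1) = 1 := by
    rw [← mul_pow, mk_one_mul_one_sub_eq_one, one_pow]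
  rw [hmk, hseries]
  linear_combination ((-1) ^ r.choose 2 * X ^ n *
    ∑ P ∈ ballotPaths (fun _ : Fin r => n), (X : ℤ⟦X⟧) ^ ascents P) * hinv
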